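/- **Setting.** Unit balls are allocated to $n$ initially empty bins. Write $x^t=(x^t_1,\dots,x^t_n)$ for the load vector after $t$ rounds, $\mathfrak F^t$ for the history of the first $t$ rounds, and $$\mathrm{Gap}(t):=\max_{i} x_i^t-\frac1n\sum_{i=1}^n x_i^t .$$ **(1) General lower bound.** For all constants $c>0$ and $c_{\max}>0$ there are constants $C,\kappa>0$ and $N$, depending only on $c$ and $c_{\max}$, such that the following holds for every $n\ge N$. Consider any process which, in each round $t\ge 0$, allocates at most $c_{\max}$ balls in total and, conditionally on $\mathfrak F^t$, allocates at least one ball to each bin $i$ with probability at least $c/n$. Then for the round $m:=\lfloor C\,n\log n\rfloor$, $$\Pr\big[\mathrm{Gap}(m)\ge \kappa\log n\big]\ \ge\ 1-n^{-1}.$$ In the processes below every sample is uniform on the $n$ bins and independent of the past and of the other samples. In (2) and (3) the bins are ranked at each time from $1$ to $n$ by non-increasing load, with ties broken in an arbitrary way determined by the history. **(2) TwinningWithQuantile.** For every constant $\delta\in(0,1)$ there are constants $C,\kappa>0$ and $N$, depending only on $\delta$, such that for all $n\ge N$ the following process satisfies $\Pr[\mathrm{Gap}(\lfloor Cn\log n\rfloor)\ge\kappa\log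 n]\ge 1-n^{-1}$: in each step, sample a bin; allocate two balls to it if its rank exceeds $n\delta$, and one ball otherwise. **(3) QuantileWithPenalty.** For every constant $\delta\in(0,1)$ there are constants $C,\kappa>0$ and $N$, depending only on $\delta$, such that for all $n\ge N$ the following process satisfies $\Pr[\mathrm{Gap}(\lfloor Cn\log n\rfloor)\ge\kappa\log n]\ge 1-n^{-1}$: in each step, sample two bins $i_1,i_2$; allocate one ball to $i_1$ if its rank exceeds $n\delta$, and otherwise two balls to $i_2$. **(4) ResetMemory.** There are constants $C,\kappa>0$ and $N$ such that for all $n\ge N$ the following process satisfies $\Pr[\mathrm{Gap}(\lfloor Cn\log n\rfloor)\ge\kappa\log n]\ge 1-n^{-1}$, where time counts single allocations: in each step $2t$, sample a bin $i_1$ and allocate one ball to it; in step $2t+1$, sample a bin $i_2$ and allocate one ball to the bin among $i_1,i_2$ with the smaller load in $x^{2t}$ (the one with the higher index in case of a tie). -/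

import Mathlib

open MeasureTheory ProbabilityTheory

universe u

namespace BallsBins

/-- The gap of a load vector: maximum load minus average load. -/
noncomputable def gap {n : ℕ} (x : Fin n → ℕ) : ℝ :=
  (⨆ i, (x i : ℝ)) - (∑ i, (x i : ℝ)) / n

/-- The load vector after adding `k` unit balls to bin `i`. -/
def allocate {n : ℕ} (x : Fin n → ℕ) (i : Fin n) (k : ℕ) : Fin n → ℕ :=
  x + Pi.single i k

/-- `x t` is the load vector after `t` rounds of a process that throws unit balls into `n`
initially empty bins; `ℱ t` is the history of the first `t` rounds. In each round at most `cmax`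
balls are allocated in total and, conditionally on the history, each bin receives at least one
ball with probability at least `c / n`. -/
structure IsAllocationProcess {Ω : Type u} {mΩ : MeasurableSpace Ω} (μ : Measure Ω)
    (ℱ : Filtration ℕ mΩ) {n : ℕ} (c cmax : ℝ) (x : ℕ → Ω → Fin n → ℕ) : Prop where
  adapted : ∀ t, Measurable[ℱ t] (x t)
  start : ∀ᵐ ω ∂μ, x 0 ω = 0
  mono : ∀ t, ∀ᵐ ω ∂μ, x t ω ≤ x (t + 1) ω
  total_le : ∀ t, ∀ᵐ ω ∂μ, (∑ i, (x (t + 1) ω i : ℝ)) - (∑ i, (x t ω i : ℝ)) ≤ cmax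
  prob_ge : ∀ t i, ∀ᵐ ω ∂μ, c / n ≤ (μ⟦{ω' | x t ω' i < x (t + 1) ω' i} | ℱ t⟧) ω

/-- `S t` is uniform on `α`, independent of the history `ℱ t`, and revealed at time `t + 1`. -/
structure IsUniformSampling {Ω : Type u} {mΩ : MeasurableSpace Ω} (μ : Measure Ω)
    (ℱ : Filtration ℕ mΩ) {α : Type} [Fintype α] [MeasurableSpace α] (S : ℕ → Ω → α) : Prop where
  adapted : ∀ t, Measurable[ℱ (t + 1)] (S t)
  uniform : ∀ t a, μ.real {ω | S t ω = a} = 1 / Fintype.card α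
  indep : ∀ t, Indep (MeasurableSpace.comap (S t) inferInstance) (ℱ t) μ

/-- `R` ranks the bins by non-increasing load (ties in any order): the bin of rank `j` is the
`j`-th heaviest. Ranks are counted from `0` here. -/
def IsRanking {n : ℕ} (x : Fin n → ℕ) (R : Equiv.Perm (Fin n)) : Prop :=
  Antitone fun j => x (R.symm j)

/-- The rankings used by the quantile processes: `R t` ranks the bins at time `t` and is
determined by the history. -/
def IsRankingProcess {Ω : Type u} {mΩ : MeasurableSpace Ω} (μ : Measure Ω)
    (ℱ : Filtration ℕ mΩ) {n : ℕ} (x : ℕ → Ω → Fin n → ℕ) (R : ℕ → Ω → Equiv.Perm (Fin n)) : Prop :=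
  (∀ t i, Measurable[ℱ t] fun ω => R t ω i) ∧ ∀ t, ∀ᵐ ω ∂μ, IsRanking (x t ω) (R t ω)

/-- Bin `i` is light: its rank, counted from `1`, exceeds `n * δ`. -/
def IsLight {n : ℕ} (δ : ℝ) (R : Equiv.Perm (Fin n)) (i : Fin n) : Prop :=
  (n : ℝ) * δ < ((R i : ℕ) : ℝ) + 1

open Classical in
/-- Twinning with quantile `δ`: sample a bin; it receives two balls if it is light and one ball
otherwise. -/
def IsTwinningWithQuantile {Ω : Type u} {mΩ : MeasurableSpace Ω} (μ : Measure Ω)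
    (ℱ : Filtration ℕ mΩ) {n : ℕ} (δ : ℝ) (x : ℕ → Ω → Fin n → ℕ) : Prop :=
  (∀ t, Measurable[ℱ t] (x t)) ∧ (∀ᵐ ω ∂μ, x 0 ω = 0) ∧
  ∃ (S : ℕ → Ω → Fin n) (R : ℕ → Ω → Equiv.Perm (Fin n)),
    IsUniformSampling μ ℱ S ∧ IsRankingProcess μ ℱ x R ∧
    ∀ t, ∀ᵐ ω ∂μ, x (t + 1) ω =
      allocate (x t ω) (S t ω) (if IsLight δ (R t ω) (S t ω) then 2 else 1)

open Classical in
/-- Quantile `δ` with penalty: sample two bins independently (the pair is uniform on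
`Fin n × Fin n`); the first receives one ball if it is light, otherwise the second receives two
balls. -/
def IsQuantileWithPenalty {Ω : Type u} {mΩ : MeasurableSpace Ω} (μ : Measure Ω)
    (ℱ : Filtration ℕ mΩ) {n : ℕ} (δ : ℝ) (x : ℕ → Ω → Fin n → ℕ) : Prop :=
  (∀ t, Measurable[ℱ t] (x t)) ∧ (∀ᵐ ω ∂μ, x 0 ω = 0) ∧
  ∃ (S : ℕ → Ω → Fin n × Fin n) (R : ℕ → Ω → Equiv.Perm (Fin n)),
    IsUniformSampling μ ℱ S ∧ IsRankingProcess μ ℱ x R ∧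
    ∀ t, ∀ᵐ ω ∂μ, x (t + 1) ω =
      if IsLight δ (R t ω) (S t ω).1 then allocate (x t ω) (S t ω).1 1
      else allocate (x t ω) (S t ω).2 2

/-- The less loaded of two bins; in case of a tie, the one with the higher index. -/
def lessLoaded {n : ℕ} (x : Fin n → ℕ) (i j : Fin n) : Fin n :=
  if x i < x j then i else if x j < x i then j else max i j

/-- Reset memory with unit balls: an even step allocates to a sampled bin `i₁`; the following odd
step samples `i₂` and allocates to the bin among `i₁`, `i₂` that was less loaded before the even
step. -/
def IsResetMemory {Ω : Type u} {mΩ : MeasurableSpace Ω} (μ : Measure Ω)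
    (ℱ : Filtration ℕ mΩ) {n : ℕ} (x : ℕ → Ω → Fin n → ℕ) : Prop :=
  (∀ t, Measurable[ℱ t] (x t)) ∧ (∀ᵐ ω ∂μ, x 0 ω = 0) ∧
  ∃ S : ℕ → Ω → Fin n, IsUniformSampling μ ℱ S ∧
    ∀ t, ∀ᵐ ω ∂μ,
      x (2 * t + 1) ω = allocate (x (2 * t) ω) (S (2 * t) ω) 1 ∧
      x (2 * t + 2) ω = allocate (x (2 * t + 1) ω)
        (lessLoaded (x (2 * t) ω) (S (2 * t) ω) (S (2 * t + 1) ω)) 1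

end BallsBins

/-!
The lower bound on the gap comes from the exponential potential `Φ(t) = ∑ i, exp (α * x i)`. Every
bin gains a ball with conditional probability at least `c / n`, so `Φ` grows in expectation by a
factor of at least `q = 1 + (exp α - 1) * (c / n)` per round, and `Φ(t) / q ^ t` is a submartingale
started at `n`. If all loads stayed below `h = (cmax + 1) * C * log n` for `m = ⌊C * n * log n⌋`
rounds, then `Φ(m) ≤ n * exp (α * h)`. For a large constant `α` (`exists_growth_rate`), `q ^ m`
exceeds `2 * exp (α * h)`, since `exp α - 1` beats every multiple of `α`. The rescaled potential
would thus have dropped to half of its starting value.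

Such a drop is unlikely. While all loads are below `h`, one round changes the rescaled potential by
at most `B = K * exp (α * h)`, with `K` constant, and for small `C` this is `K * n ^ (1 / 8)`, so
that `B * √m` is far smaller than the drop of `n / 2`. This Azuma-type bound
is run without stopping times: since loads never decrease, the weight
`exp (-s * Φ(t) / q ^ t)`, set to `0` once some load reaches `h` (`truncWeight`), has an expectation
that grows by a factor of at most `1 + (s * B) ^ 2` per round (`truncWeight_step`,
`IsAllocationProcess.integral_truncWeight_succ_le`). With `s = n ^ (-1 / 2)` this gives
`IsAllocationProcess.measureReal_forall_lt_le` and a failure probability of at most `1 / n`. When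
some load reaches `h`, the gap is at least `C * log n`, because the average load at time `m` is at
most `cmax * C * log n`.

The concrete processes are instances of the general one. A uniform sample independent of the past
hits a history-dependent set with conditional probability equal to its density
(`IsUniformSampling.le_condExp`). Twinning has `c = 1`; the quantile process with penalty has
`c = δ / 2`, because about `n * δ` bins are heavy; and in the reset memory process the rounds are
pairs of consecutive steps, the first of which already gives `c = 1`.
-/

namespace BallsBins

/-! ### Conditional lower bounds -/

/-- Integrated form of a lower bound on a conditional probability, tested against a bounded
multiplier that is determined by the history. -/
lemma mul_integral_le_of_le_condExp {Ω : Type*} {m mΩ : MeasurableSpace Ω} (hm : m ≤ mΩ)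
    {μ : Measure Ω} [IsProbabilityMeasure μ] {A : Set Ω} (hA : MeasurableSet A) {p : ℝ}
    (hp : ∀ᵐ ω ∂μ, p ≤ (μ⟦A | m⟧) ω) {g : Ω → ℝ} (hg : Measurable[m] g) (hg0 : 0 ≤ g) {M : ℝ}
    (hgM : ∀ ω, g ω ≤ M) :
    p * ∫ ω, g ω ∂μ ≤ ∫ ω, g ω * A.indicator (fun _ => (1 : ℝ)) ω ∂μ := by
  have hgb : ∀ᵐ ω ∂μ, ‖g ω‖ ≤ M :=
    Filter.Eventually.of_forall fun ω => by rw [Real.norm_of_nonneg (hg0 ω)]; exact hgM ω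
  have hgs : AEStronglyMeasurable g μ := (hg.mono hm le_rfl).aestronglyMeasurable
  have hgi : Integrable g μ := (integrable_const M).mono' hgs hgb
  have hAi : Integrable (A.indicator fun _ => (1 : ℝ)) μ := (integrable_const 1).indicator hA
  have hgA : Integrable (g * A.indicator fun _ => (1 : ℝ)) μ := hAi.bdd_mul hgs hgb
  have hce : μ[g * A.indicator (fun _ => (1 : ℝ)) | m] =ᵐ[μ] g * μ⟦A | m⟧ :=
    condExp_mul_of_stronglyMeasurable_left hg.stronglyMeasurable hgA hAi
  have hint : ∫ ω, g ω * A.indicator (fun _ => (1 : ℝ)) ω ∂μ = ∫ ω, g ω * (μ⟦A | m⟧) ω ∂μ := by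
    calc _ = ∫ ω, (μ[g * A.indicator (fun _ => (1 : ℝ)) | m]) ω ∂μ :=
          (integral_condExp hm (f := g * A.indicator fun _ => (1 : ℝ))).symm
      _ = _ := integral_congr_ae hce
  rw [hint, ← integral_const_mul]
  refine integral_mono_ae (hgi.const_mul p) (integrable_condExp.bdd_mul hgs hgb) ?_
  filter_upwards [hp] with ω hω
  rw [mul_comm]
  exact mul_le_mul_of_nonneg_left hω (hg0 ω)

/-- A uniform sample that is independent of the history hits a history-dependent set of size at
least `p * |α|` with conditional probability at least `p`. -/
lemma IsUniformSampling.le_condExp {Ω : Type u} {mΩ : MeasurableSpace Ω} {μ : Measure Ω}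
    [IsProbabilityMeasure μ] {ℱ : Filtration ℕ mΩ} {α : Type} [Fintype α] [MeasurableSpace α]
    [MeasurableSingletonClass α] {S : ℕ → Ω → α} (hS : IsUniformSampling μ ℱ S) (t : ℕ)
    {D : Ω → α → Prop} [∀ ω, DecidablePred (D ω)]
    (hD : ∀ a, MeasurableSet[ℱ t] {ω | D ω a}) {A : Set Ω} (hA : MeasurableSet A)
    (hDA : ∀ᵐ ω ∂μ, D ω (S t ω) → ω ∈ A) {p : ℝ}
    (hp : ∀ᵐ ω ∂μ, p * Fintype.card α ≤ (Finset.univ.filter (D ω)).card) (hα : 0 < Fintype.card α) :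
    ∀ᵐ ω ∂μ, p ≤ (μ⟦A | ℱ t⟧) ω := by
  have hα' : (0 : ℝ) < Fintype.card α := by exact_mod_cast hα
  have hSm : ∀ a, MeasurableSet {ω | S t ω = a} := fun a =>
    ℱ.le (t + 1) _ (hS.adapted t (measurableSet_singleton a))
  set E : α → Set Ω := fun a => {ω | D ω a} ∩ {ω | S t ω = a} with hE
  have hone : ∀ a, μ⟦E a | ℱ t⟧ =ᵐ[μ]
      fun ω => {ω | D ω a}.indicator (fun _ => (1 : ℝ)) ω * (1 / Fintype.card α) := by
    intro a
    have hSi : Integrable ({ω | S t ω = a}.indicator fun _ => (1 : ℝ)) μ :=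
      (integrable_const 1).indicator (hSm a)
    have h1 : (E a).indicator (fun _ => (1 : ℝ)) =
        {ω | D ω a}.indicator ({ω | S t ω = a}.indicator fun _ => (1 : ℝ)) := by
      rw [Set.indicator_indicator]
    have h2 : μ⟦{ω | S t ω = a} | ℱ t⟧ =ᵐ[μ] fun _ => 1 / (Fintype.card α : ℝ) := by
      have hle : MeasurableSpace.comap (S t) inferInstance ≤ mΩ :=
        ((hS.adapted t).mono (ℱ.le (t + 1)) le_rfl).comap_le
      have hsm : StronglyMeasurable[MeasurableSpace.comap (S t) inferInstance]
          ({ω | S t ω = a}.indicator fun _ => (1 : ℝ)) :=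
        stronglyMeasurable_const.indicator ⟨{a}, measurableSet_singleton a, rfl⟩
      refine (condExp_indep_eq hle (ℱ.le t) hsm (hS.indep t)).trans ?_
      rw [integral_indicator_const _ (hSm a), hS.uniform t a]
      simp
    rw [h1]
    refine (condExp_indicator hSi (hD a)).trans ?_
    filter_upwards [h2] with ω hω
    by_cases h : D ω a <;> simp [Set.indicator, h, hω]
  have hEi : ∀ a, Integrable ((E a).indicator fun _ => (1 : ℝ)) μ := fun a =>
    (integrable_const 1).indicator ((ℱ.le t _ (hD a)).inter (hSm a))
  have hle : (fun ω => ∑ a, (E a).indicator (fun _ => (1 : ℝ)) ω) ≤ᵐ[μ]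
      A.indicator fun _ => (1 : ℝ) := by
    filter_upwards [hDA] with ω hω
    rw [Finset.sum_eq_single (S t ω)]
    · by_cases h : D ω (S t ω)
      · simp [hE, h, hω h]
      · simp only [hE, Set.indicator, Set.mem_inter_iff, Set.mem_ofPred_eq, h, false_and, if_false]
        split_ifs <;> norm_num
    · intro a _ ha
      simp [hE, Set.indicator, Ne.symm ha]
    · simp
  have hsum := condExp_finsetSum (μ := μ) (m := ℱ t) (s := Finset.univ)
    (f := fun a => (E a).indicator fun _ => (1 : ℝ)) fun a _ => hEi a
  have hmono := condExp_mono (m := ℱ t) (integrable_finsetSum Finset.univ fun a _ => hEi a)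
    ((integrable_const (1 : ℝ)).indicator hA) hle
  have hall := ae_all_iff.2 hone
  have hfun : (fun ω => ∑ a, (E a).indicator (fun _ => (1 : ℝ)) ω) =
      ∑ a, (E a).indicator fun _ => (1 : ℝ) := by ext; simp
  rw [hfun] at hmono
  filter_upwards [hsum, hmono, hall, hp] with ω h1 h2 h3 h4
  refine le_trans ?_ h2
  rw [h1, Finset.sum_apply, Finset.sum_congr rfl fun a _ => h3 a, ← Finset.sum_mul, mul_one_div,
    le_div_iff₀ hα']
  simpa [Set.indicator, Finset.sum_boole] using h4

/-! ### The exponential potential -/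

/-- The exponential potential `∑ i, exp (α * x i)` of a load vector. -/
noncomputable def expPotential {n : ℕ} (α : ℝ) (x : Fin n → ℕ) : ℝ :=
  ∑ i, Real.exp (α * x i)

lemma expPotential_nonneg {n : ℕ} (α : ℝ) (x : Fin n → ℕ) : 0 ≤ expPotential α x :=
  Finset.sum_nonneg fun _ _ => (Real.exp_pos _).le

lemma expPotential_le {n : ℕ} {α h : ℝ} (hα : 0 ≤ α) {x : Fin n → ℕ} (hx : ∀ i, (x i : ℝ) ≤ h) :
    expPotential α x ≤ n * Real.exp (α * h) := by
  calc expPotential α x ≤ ∑ _i : Fin n, Real.exp (α * h) :=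
        Finset.sum_le_sum fun i _ => Real.exp_le_exp.2 (mul_le_mul_of_nonneg_left (hx i) hα)
    _ = n * Real.exp (α * h) := by simp

/-- One round that adds at most `k` balls to loads at most `h` raises the potential by a bounded
amount: a bin that gains `d ≥ 1` balls gains at most `exp (α * (h + k)) ≤ d * exp (α * (h + k))`. -/
lemma expPotential_sub_le {n : ℕ} {α h k : ℝ} (hα : 0 ≤ α) {x y : Fin n → ℕ}
    (hx : ∀ i, (x i : ℝ) ≤ h) (hxy : x ≤ y) (hk : (∑ i, (y i : ℝ)) - ∑ i, (x i : ℝ) ≤ k) :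
    expPotential α y - expPotential α x ≤ k * Real.exp (α * k) * Real.exp (α * h) := by
  have hd : ∀ i, (0 : ℝ) ≤ y i - x i := fun i => sub_nonneg.2 (by exact_mod_cast hxy i)
  have hsum : ∑ i, ((y i : ℝ) - x i) ≤ k := by rwa [Finset.sum_sub_distrib]
  have hdk : ∀ i, (y i : ℝ) - x i ≤ k := fun i =>
    (Finset.single_le_sum (fun j _ => hd j) (Finset.mem_univ i)).trans hsum
  have hterm : ∀ i, Real.exp (α * y i) - Real.exp (α * x i) ≤
      ((y i : ℝ) - x i) * (Real.exp (α * k) * Real.exp (α * h)) := by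
    intro i
    rcases (hxy i).eq_or_lt with he | hlt
    · simp [he]
    · have h1 : (1 : ℝ) ≤ y i - x i := by
        have : (x i : ℝ) + 1 ≤ y i := by exact_mod_cast hlt
        linarith
      have h2 : Real.exp (α * y i) ≤ Real.exp (α * k) * Real.exp (α * h) := by
        rw [← Real.exp_add, ← mul_add]
        exact Real.exp_le_exp.2 (mul_le_mul_of_nonneg_left (by linarith [hdk i, hx i]) hα)
      have h3 : 0 < Real.exp (α * k) * Real.exp (α * h) := by positivity
      have h4 := mul_le_mul_of_nonneg_right h1 h3.le
      linarith [Real.exp_pos (α * x i)]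
  rw [expPotential, expPotential, ← Finset.sum_sub_distrib, mul_assoc]
  refine (Finset.sum_le_sum fun i _ => hterm i).trans ?_
  rw [← Finset.sum_mul]
  exact mul_le_mul_of_nonneg_right hsum (by positivity)

lemma le_expPotential_sub {n : ℕ} {α : ℝ} (hα : 0 ≤ α) {x y : Fin n → ℕ} (hxy : x ≤ y) :
    (Real.exp α - 1) * ∑ i, Real.exp (α * x i) * (if x i < y i then 1 else 0) ≤
      expPotential α y - expPotential α x := by
  rw [expPotential, expPotential, ← Finset.sum_sub_distrib, Finset.mul_sum]
  refine Finset.sum_le_sum fun i _ => ?_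
  split_ifs with h
  · have h1 : (x i : ℝ) + 1 ≤ y i := by exact_mod_cast h
    have h2 : Real.exp (α * x i) * Real.exp α ≤ Real.exp (α * y i) := by
      rw [← Real.exp_add]
      exact Real.exp_le_exp.2 (by nlinarith)
    linarith
  · have : x i = y i := le_antisymm (hxy i) (not_lt.1 h)
    simp [this]

open Classical in
/-- The weight `exp (-b * Φ)`, `Φ` the exponential potential, of a load vector whose maximum is
below `h`; other load vectors have weight `0`. -/
noncomputable def truncWeight {n : ℕ} (α h b : ℝ) (x : Fin n → ℕ) : ℝ :=
  if ∀ i, (x i : ℝ) < h then Real.exp (-(b * expPotential α x)) else 0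

lemma truncWeight_nonneg {n : ℕ} (α h b : ℝ) (x : Fin n → ℕ) : 0 ≤ truncWeight α h b x := by
  unfold truncWeight; split_ifs <;> positivity

lemma truncWeight_le_one {n : ℕ} (α h : ℝ) {b : ℝ} (hb : 0 ≤ b) (x : Fin n → ℕ) :
    truncWeight α h b x ≤ 1 := by
  unfold truncWeight
  split_ifs
  · exact Real.exp_le_one_iff.2 (neg_nonpos.2 (mul_nonneg hb (expPotential_nonneg α x)))
  · exact zero_le_one

lemma truncWeight_mul_exp_le {n : ℕ} {α h b : ℝ} (hα : 0 ≤ α) (hb : 0 ≤ b) (x : Fin n → ℕ)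
    (i : Fin n) : truncWeight α h b x * Real.exp (α * x i) ≤ Real.exp (α * h) := by
  by_cases hx : ∀ i, (x i : ℝ) < h
  · calc _ ≤ 1 * Real.exp (α * h) := by
          gcongr
          · exact truncWeight_le_one α h hb x
          · exact (hx i).le
      _ = _ := one_mul _
  · simp only [truncWeight, hx, if_false, zero_mul]
    positivity

/-- One round, pointwise: up to the factor `1 + (s * B) ^ 2`, the weight changes by at most the
drift term, whose conditional expectation is nonnegative. Here `b'` and `b' * q` are the scales
of the potential after and before the round, `q = 1 + (exp α - 1) * p`. -/
lemma truncWeight_step {n : ℕ} {α h k p b' B : ℝ} (hα : 0 ≤ α) (hp : 0 ≤ p) (hb : 0 ≤ b')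
    {x y : Fin n → ℕ} (hxy : x ≤ y) (hk : (∑ i, (y i : ℝ)) - ∑ i, (x i : ℝ) ≤ k)
    (hB1 : k * Real.exp (α * k) * Real.exp (α * h) ≤ B)
    (hB2 : (Real.exp α - 1) * p * (n * Real.exp (α * h)) ≤ B) {s : ℝ} (hs : b' ≤ s)
    (hsB : s * B ≤ 1) :
    truncWeight α h b' y ≤ (1 + (s * B) ^ 2) * truncWeight α h (b' * (1 + (Real.exp α - 1) * p)) x
      - b' * (Real.exp α - 1) * ∑ i,
        (truncWeight α h (b' * (1 + (Real.exp α - 1) * p)) x * Real.exp (α * x i) *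
            (if x i < y i then 1 else 0)
          - p * (truncWeight α h (b' * (1 + (Real.exp α - 1) * p)) x * Real.exp (α * x i))) := by
  have hα1 : 0 ≤ Real.exp α - 1 := by linarith [Real.add_one_le_exp α]
  set b := b' * (1 + (Real.exp α - 1) * p) with hbdef
  by_cases hx : ∀ i, (x i : ℝ) < h
  swap
  -- loads never decrease, so a configuration that has left the truncation never returns
  · have hy : ¬ ∀ i, (y i : ℝ) < h := fun hy => hx fun i =>
      lt_of_le_of_lt (by exact_mod_cast hxy i) (hy i)
    simp [truncWeight, hx, hy]
  have hB0 : 0 ≤ B := le_trans (by positivity) hB2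
  have hs0 : 0 ≤ s := hb.trans hs
  set D := expPotential α y - (1 + (Real.exp α - 1) * p) * expPotential α x with hD
  have hΦx := expPotential_nonneg α x
  have hup := expPotential_sub_le hα (fun i => (hx i).le) hxy hk
  have hlow := le_expPotential_sub hα hxy
  have hΦle := expPotential_le hα fun i => (hx i).le
  have hmonoΦ : 0 ≤ expPotential α y - expPotential α x :=
    le_trans (mul_nonneg hα1 (Finset.sum_nonneg fun i _ => by positivity)) hlow
  have hdec : (Real.exp α - 1) * p * expPotential α x ≤ B :=
    (mul_le_mul_of_nonneg_left hΦle (mul_nonneg hα1 hp)).trans hB2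
  have hdec0 : 0 ≤ (Real.exp α - 1) * p * expPotential α x := by positivity
  have hDabs : |D| ≤ B := abs_le.2 ⟨by rw [hD]; nlinarith, by rw [hD]; nlinarith⟩
  have hzabs : |-(b' * D)| ≤ s * B := by
    rw [abs_neg, abs_mul, abs_of_nonneg hb]
    exact mul_le_mul hs hDabs (abs_nonneg _) hs0
  have hexp : Real.exp (-(b' * D)) ≤ 1 - b' * D + (s * B) ^ 2 := by
    have h1 := (abs_le.1 (Real.abs_exp_sub_one_sub_id_le (hzabs.trans hsB))).2
    have h2 : (-(b' * D)) ^ 2 ≤ (s * B) ^ 2 := sq_le_sq' (by linarith [(abs_le.1 hzabs).1])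
      (abs_le.1 hzabs).2
    linarith
  set w := Real.exp (-(b * expPotential α x)) with hw
  have hwx : truncWeight α h b x = w := by simp [truncWeight, hx, hw]
  have hwy : truncWeight α h b' y ≤ w * Real.exp (-(b' * D)) := by
    rw [hw, ← Real.exp_add]
    have : -(b * expPotential α x) + -(b' * D) = -(b' * expPotential α y) := by
      rw [hbdef, hD]; ring
    rw [this, truncWeight]
    split_ifs <;> first | exact le_rfl | positivity
  have hw0 : 0 < w := Real.exp_pos _
  have hsum : ∑ i, (w * Real.exp (α * x i) * (if x i < y i then 1 else 0)
          - p * (w * Real.exp (α * x i))) =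
      w * (∑ i, Real.exp (α * x i) * (if x i < y i then 1 else 0) - p * expPotential α x) := by
    rw [expPotential, Finset.mul_sum, ← Finset.sum_sub_distrib, Finset.mul_sum]
    exact Finset.sum_congr rfl fun i _ => by ring
  rw [hwx, hsum]
  set T := ∑ i, Real.exp (α * x i) * (if x i < y i then (1 : ℝ) else 0)
  have hT : (Real.exp α - 1) * (T - p * expPotential α x) ≤ D := by rw [hD]; linarith
  calc _ ≤ w * Real.exp (-(b' * D)) := hwy
    _ ≤ w * (1 - b' * ((Real.exp α - 1) * (T - p * expPotential α x)) + (s * B) ^ 2) := by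
        refine mul_le_mul_of_nonneg_left (hexp.trans ?_) hw0.le
        linarith [mul_le_mul_of_nonneg_left hT hb]
    _ = _ := by ring

/-! ### The general lower bound -/

section AllocationProcess

variable {Ω : Type u} {mΩ : MeasurableSpace Ω} {μ : Measure Ω} {ℱ : Filtration ℕ mΩ} {n : ℕ}
  {c cmax : ℝ} {x : ℕ → Ω → Fin n → ℕ}

lemma IsAllocationProcess.measurable (hx : IsAllocationProcess μ ℱ c cmax x) (t : ℕ) :
    Measurable (x t) :=
  (hx.adapted t).mono (ℱ.le t) le_rfl

lemma measurableSet_lt {x y : Ω → Fin n → ℕ} (hx : Measurable x) (hy : Measurable y) (i : Fin n) :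
    MeasurableSet {ω | x ω i < y ω i} :=
  _root_.measurableSet_lt ((measurable_pi_apply i).comp hx) ((measurable_pi_apply i).comp hy)

lemma IsAllocationProcess.total_le_mul (hx : IsAllocationProcess μ ℱ c cmax x) (m : ℕ) :
    ∀ᵐ ω ∂μ, ∑ i, (x m ω i : ℝ) ≤ m * cmax := by
  filter_upwards [hx.start, ae_all_iff.2 hx.total_le] with ω h0 h1
  induction m with
  | zero => simp [h0]
  | succ m ih => push_cast; linarith [h1 m]

lemma le_gap_of_le {n : ℕ} {x : Fin n → ℕ} {i : Fin n} {a b : ℝ} (hi : a ≤ x i)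
    (hs : (∑ j, (x j : ℝ)) / n ≤ b) : a - b ≤ gap x := by
  have := le_ciSup (Set.finite_range fun j => (x j : ℝ)).bddAbove i
  unfold gap
  linarith

variable [IsProbabilityMeasure μ]

lemma integrable_truncWeight {y : Ω → Fin n → ℕ} (hy : Measurable y) (α h : ℝ) {b : ℝ}
    (hb : 0 ≤ b) : Integrable (fun ω => truncWeight α h b (y ω)) μ := by
  refine (integrable_const (1 : ℝ)).mono'
    ((Measurable.of_discrete (f := truncWeight α h b)).comp hy).aestronglyMeasurable
    (Filter.Eventually.of_forall fun ω => ?_)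
  rw [Real.norm_of_nonneg (truncWeight_nonneg α h b _)]
  exact truncWeight_le_one α h hb _

/-- The drift term of `truncWeight_step` integrates to something nonnegative, because every bin
gains a ball with conditional probability at least `c / n`. -/
lemma IsAllocationProcess.integral_truncWeight_succ_le (hx : IsAllocationProcess μ ℱ c cmax x)
    {α h b' B s : ℝ} (hα : 0 ≤ α) (hc : 0 ≤ c) (hb : 0 ≤ b')
    (hB1 : cmax * Real.exp (α * cmax) * Real.exp (α * h) ≤ B)
    (hB2 : (Real.exp α - 1) * (c / n) * (n * Real.exp (α * h)) ≤ B) (hs : b' ≤ s)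
    (hsB : s * B ≤ 1) (t : ℕ) :
    ∫ ω, truncWeight α h b' (x (t + 1) ω) ∂μ ≤ (1 + (s * B) ^ 2) *
      ∫ ω, truncWeight α h (b' * (1 + (Real.exp α - 1) * (c / n))) (x t ω) ∂μ := by
  have hα1 : 0 ≤ Real.exp α - 1 := by linarith [Real.add_one_le_exp α]
  have hp : 0 ≤ c / n := by positivity
  set b := b' * (1 + (Real.exp α - 1) * (c / n)) with hbdef
  have hb0 : 0 ≤ b := by positivity
  have hm : ∀ i, MeasurableSet {ω | x t ω i < x (t + 1) ω i} := fun i =>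
    measurableSet_lt (hx.measurable t) (hx.measurable (t + 1)) i
  -- the weighted exponential of a single bin, the multiplier of the drift of that bin
  set g : Fin n → Ω → ℝ := fun i ω => truncWeight α h b (x t ω) * Real.exp (α * x t ω i) with hg
  have hgm : ∀ i, Measurable[ℱ t] (g i) := fun i =>
    (Measurable.of_discrete
      (f := fun z : Fin n → ℕ => truncWeight α h b z * Real.exp (α * z i))).comp (hx.adapted t)
  have hg0 : ∀ i, 0 ≤ g i := fun i ω => mul_nonneg (truncWeight_nonneg _ _ _ _) (Real.exp_pos _).le
  have hgM : ∀ i ω, g i ω ≤ Real.exp (α * h) := fun i ω => truncWeight_mul_exp_le hα hb0 _ i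
  have hgb : ∀ i, ∀ᵐ ω ∂μ, ‖g i ω‖ ≤ Real.exp (α * h) := fun i =>
    Filter.Eventually.of_forall fun ω => by rw [Real.norm_of_nonneg (hg0 i ω)]; exact hgM i ω
  have hgs : ∀ i, AEStronglyMeasurable (g i) μ := fun i =>
    ((hgm i).mono (ℱ.le t) le_rfl).aestronglyMeasurable
  have hgi : ∀ i, Integrable (g i) μ := fun i => (integrable_const _).mono' (hgs i) (hgb i)
  set I : Fin n → Ω → ℝ := fun i => {ω | x t ω i < x (t + 1) ω i}.indicator fun _ => (1 : ℝ)
  have hgI : ∀ i, Integrable (fun ω => g i ω * I i ω) μ := fun i =>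
    ((integrable_const (1 : ℝ)).indicator (hm i)).bdd_mul (hgs i) (hgb i)
  have hdi : ∀ i, Integrable (fun ω => g i ω * I i ω - c / n * g i ω) μ := fun i =>
    (hgI i).sub ((hgi i).const_mul _)
  have hdrift : 0 ≤ ∫ ω, ∑ i, (g i ω * I i ω - c / n * g i ω) ∂μ := by
    rw [integral_finsetSum _ fun i _ => hdi i]
    refine Finset.sum_nonneg fun i _ => ?_
    rw [integral_sub (hgI i) ((hgi i).const_mul _), integral_const_mul, sub_nonneg]
    exact mul_integral_le_of_le_condExp (ℱ.le t) (hm i) (hx.prob_ge t i) (hgm i) (hg0 i) (hgM i)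
  have hVi := integrable_truncWeight (μ := μ) (hx.measurable t) α h hb0
  have hsi := integrable_finsetSum Finset.univ fun i (_ : i ∈ Finset.univ) => hdi i
  calc _ ≤ ∫ ω, ((1 + (s * B) ^ 2) * truncWeight α h b (x t ω)
        - b' * (Real.exp α - 1) * ∑ i, (g i ω * I i ω - c / n * g i ω)) ∂μ := by
        refine integral_mono_ae (integrable_truncWeight (hx.measurable (t + 1)) α h hb)
          ((hVi.const_mul _).sub (hsi.const_mul _)) ?_
        filter_upwards [hx.mono t, hx.total_le t] with ω h1 h2
        have := truncWeight_step hα hp hb h1 h2 hB1 hB2 hs hsB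
        refine this.trans_eq ?_
        congr 2
        refine Finset.sum_congr rfl fun i _ => ?_
        by_cases hi : x t ω i < x (t + 1) ω i <;> simp [I, hg, hi, ← hbdef]
    _ = (1 + (s * B) ^ 2) * ∫ ω, truncWeight α h b (x t ω) ∂μ
        - b' * (Real.exp α - 1) * ∫ ω, ∑ i, (g i ω * I i ω - c / n * g i ω) ∂μ := by
        rw [integral_sub (hVi.const_mul _) (hsi.const_mul _), integral_const_mul,
          integral_const_mul]
    _ ≤ _ := sub_le_self _ (by positivity)

/-- Iteration of the one-round estimate from the empty configuration, with the potential at time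
`t` rescaled by the deterministic growth `q ^ t`, `q = 1 + (exp α - 1) * (c / n)`. -/
lemma IsAllocationProcess.integral_truncWeight_le (hx : IsAllocationProcess μ ℱ c cmax x)
    {α h B s : ℝ} (hα : 0 ≤ α) (hc : 0 ≤ c) (hs : 0 ≤ s)
    (hB1 : cmax * Real.exp (α * cmax) * Real.exp (α * h) ≤ B)
    (hB2 : (Real.exp α - 1) * (c / n) * (n * Real.exp (α * h)) ≤ B)
    (hsB : s * B ≤ 1) (t : ℕ) :
    ∫ ω, truncWeight α h (s / (1 + (Real.exp α - 1) * (c / n)) ^ t) (x t ω) ∂μ ≤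
      (1 + (s * B) ^ 2) ^ t * Real.exp (-(s * n)) := by
  have hα1 : 0 ≤ Real.exp α - 1 := by linarith [Real.add_one_le_exp α]
  have hr : 0 ≤ (Real.exp α - 1) * (c / n) := by positivity
  induction t with
  | zero =>
    calc _ ≤ ∫ _ω, Real.exp (-(s * n)) ∂μ := by
          refine integral_mono_ae (integrable_truncWeight (hx.measurable 0) α h (by simpa using hs))
            (integrable_const _) ?_
          filter_upwards [hx.start] with ω hω
          rw [hω, truncWeight]
          split_ifs
          · simp [expPotential]
          · positivity
      _ = _ := by simp
  | succ t ih =>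
    refine (hx.integral_truncWeight_succ_le hα hc (by positivity) hB1 hB2
      (div_le_self hs (one_le_pow₀ (by linarith))) hsB t).trans ?_
    have : s / (1 + (Real.exp α - 1) * (c / n)) ^ (t + 1) * (1 + (Real.exp α - 1) * (c / n)) =
        s / (1 + (Real.exp α - 1) * (c / n)) ^ t := by
      rw [pow_succ]; field_simp
    rw [this, pow_succ' (1 + (s * B) ^ 2), mul_assoc]
    exact mul_le_mul_of_nonneg_left ih (by positivity)

/-- Once the deterministic growth `q ^ m` exceeds `2 * exp (α * h)`, all loads being below `h`
would force the rescaled potential down to half of its initial value `n`, which is unlikely. -/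
lemma IsAllocationProcess.measureReal_forall_lt_le (hx : IsAllocationProcess μ ℱ c cmax x)
    {α h B s : ℝ} (hα : 0 ≤ α) (hc : 0 ≤ c) (hs : 0 ≤ s)
    (hB1 : cmax * Real.exp (α * cmax) * Real.exp (α * h) ≤ B)
    (hB2 : (Real.exp α - 1) * (c / n) * (n * Real.exp (α * h)) ≤ B)
    (hsB : s * B ≤ 1) {m : ℕ}
    (hm : 2 * Real.exp (α * h) ≤ (1 + (Real.exp α - 1) * (c / n)) ^ m) :
    μ.real {ω | ∀ i, (x m ω i : ℝ) < h} ≤ Real.exp (m * (s * B) ^ 2 - s * n / 2) := by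
  have hα1 : 0 ≤ Real.exp α - 1 := by linarith [Real.add_one_le_exp α]
  set q := 1 + (Real.exp α - 1) * (c / n) with hq
  have hq0 : 0 < q := by positivity
  set G := {ω | ∀ i, (x m ω i : ℝ) < h} with hG
  have hGm : MeasurableSet G := hx.measurable m
    (MeasurableSet.of_discrete (s := {z : Fin n → ℕ | ∀ i, (z i : ℝ) < h}))
  have hlow : Real.exp (-(s * n / 2)) * μ.real G ≤
      ∫ ω, truncWeight α h (s / q ^ m) (x m ω) ∂μ := by
    rw [mul_comm, ← smul_eq_mul, ← integral_indicator_const _ hGm]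
    refine integral_mono ((integrable_const _).indicator hGm)
      (integrable_truncWeight (hx.measurable m) α h (by positivity)) fun ω => ?_
    by_cases hω : ω ∈ G
    · have hω' : ∀ i, (x m ω i : ℝ) < h := hω
      simp only [Set.indicator_of_mem hω, truncWeight, if_pos hω']
      refine Real.exp_le_exp.2 (neg_le_neg ?_)
      have h1 := expPotential_le hα fun i => (hω' i).le
      rw [div_mul_eq_mul_div, div_le_iff₀ (by positivity)]
      calc s * expPotential α (x m ω) ≤ s * (n * Real.exp (α * h)) :=
            mul_le_mul_of_nonneg_left h1 hs
        _ = s * n / 2 * (2 * Real.exp (α * h)) := by ring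
        _ ≤ _ := mul_le_mul_of_nonneg_left hm (by positivity)
    · simpa [Set.indicator_of_notMem hω] using truncWeight_nonneg _ _ _ _
  have hup := hx.integral_truncWeight_le hα hc hs hB1 hB2 hsB m
  have hpow : (1 + (s * B) ^ 2) ^ m ≤ Real.exp (m * (s * B) ^ 2) := by
    rw [Real.exp_nat_mul]
    exact pow_le_pow_left₀ (by positivity) (by linarith [Real.add_one_le_exp ((s * B) ^ 2)]) m
  have h1 : Real.exp (-(s * n / 2)) * μ.real G ≤
      Real.exp (-(s * n / 2)) * Real.exp (m * (s * B) ^ 2 - s * n / 2) := by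
    refine hlow.trans (hup.trans ((mul_le_mul_of_nonneg_right hpow (Real.exp_pos _).le).trans ?_))
    rw [← Real.exp_add, ← Real.exp_add]
    exact Real.exp_le_exp.2 (by linarith)
  exact le_of_mul_le_mul_left h1 (Real.exp_pos _)

lemma one_sub_inv_le_measureReal {G H : Set Ω} (hG : MeasurableSet G) {ε : ℝ}
    (hε : μ.real G ≤ ε) (hGH : ∀ᵐ ω ∂μ, ω ∉ G → ω ∈ H) : 1 - ε ≤ μ.real H := by
  have h1 : μ.real Gᶜ ≤ μ.real H :=
    ENNReal.toReal_mono (measure_ne_top μ H) (measure_mono_ae hGH)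
  rw [probReal_compl_eq_one_sub hG] at h1
  linarith

end AllocationProcess

/-- The choice of constants: `α` makes the growth rate `(exp α - 1) * c` of the potential beat
`α` times the threshold `(cmax + 1) * C * log n` for the load. -/
lemma exists_growth_rate {c cmax : ℝ} (hc : 0 < c) (hcm : 0 < cmax) :
    ∃ α : ℝ, 0 < α ∧ α * (cmax + 1) + 1 ≤ (Real.exp α - 1) * c / 4 := by
  refine ⟨8 * (cmax + 2) / c + 1, by positivity, ?_⟩
  set α := 8 * (cmax + 2) / c + 1 with hα
  have h1 : 1 ≤ α := by rw [hα]; linarith [show 0 ≤ 8 * (cmax + 2) / c by positivity]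
  have h2 : 8 * (cmax + 2) ≤ α * c := by
    rw [hα, add_mul, div_mul_cancel₀ _ hc.ne']; linarith
  have h3 := Real.quadratic_le_exp_of_nonneg (by linarith : 0 ≤ α)
  have h4 : α ^ 2 / 2 * c ≤ (Real.exp α - 1) * c :=
    mul_le_mul_of_nonneg_right (by linarith) hc.le
  nlinarith

/-- The largeness conditions on `n`. With `u = exp (log n / 8) = n ^ (1 / 8)`, the last two say that
the exponent moves by at most `1` per round and that the error term `K ^ 2 * C * u ^ 2 * log n`
together with `log n` stays below the main term `u ^ 4 / 2`. -/
lemma eventually_growth_le (K L C : ℝ) (hC : 0 < C) : ∃ N : ℕ, ∀ n : ℕ, N ≤ n →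
    1 ≤ n ∧ 1 ≤ Real.log n ∧ L ≤ n ∧ 2 ≤ C * (n * Real.log n) ∧ Real.log 2 ≤ C * Real.log n ∧
      K ≤ Real.exp (Real.log n / 8) ∧
      (K ^ 2 * C + 1) * Real.log n ≤ Real.exp (Real.log n / 8) ^ 2 / 2 := by
  have hlog : Filter.Tendsto (fun n : ℕ => Real.log n) Filter.atTop Filter.atTop :=
    Real.tendsto_log_atTop.comp tendsto_natCast_atTop_atTop
  have hu : Filter.Tendsto (fun n : ℕ => Real.exp (Real.log n / 8)) Filter.atTop Filter.atTop :=
    Real.tendsto_exp_atTop.comp (hlog.atTop_div_const (by norm_num))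
  have hn : Filter.Tendsto (fun n : ℕ => (n : ℝ)) Filter.atTop Filter.atTop :=
    tendsto_natCast_atTop_atTop
  have e1 : ∀ᶠ n : ℕ in Filter.atTop, 16 * (K ^ 2 * C + 1) ≤ Real.exp (Real.log n / 8) :=
    hu.eventually_ge_atTop _
  have e2 := hlog.eventually_ge_atTop (2 / C + 1)
  have hlog2 : Real.log 2 ≤ 1 := by linarith [Real.log_two_lt_d9]
  refine Filter.eventually_atTop.1 ?_
  filter_upwards [Filter.eventually_ge_atTop 1, hn.eventually_ge_atTop L,
    hu.eventually_ge_atTop K, e1, e2] with n h1 h3 h5 h6 h7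
  have hn1 : (1 : ℝ) ≤ n := by exact_mod_cast h1
  have hd : 0 ≤ 2 / C := by positivity
  have hl1 : 1 ≤ Real.log n := by linarith
  have h8 : 2 ≤ C * Real.log n := by
    have : 2 / C ≤ Real.log n := by linarith
    rwa [div_le_iff₀' hC] at this
  refine ⟨h1, hl1, h3, ?_, by linarith, h5, ?_⟩
  · nlinarith
  · have h9 : Real.log n / 8 ≤ Real.exp (Real.log n / 8) := by
      linarith [Real.add_one_le_exp (Real.log n / 8)]
    have h10 : (0 : ℝ) < K ^ 2 * C + 1 := by positivity
    nlinarith [Real.exp_pos (Real.log n / 8)]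

/-- The threshold for the loads is `h = (cmax + 1) * C * log n`; as the average load at the final
time is at most `cmax * C * log n`, a bin with load `h` has excess `C * log n`. -/
theorem IsAllocationProcess.exists_gap_ge (c cmax : ℝ) (hc : 0 < c) (hcm : 0 < cmax) :
    ∃ C κ : ℝ, 0 < C ∧ 0 < κ ∧ ∃ N : ℕ, ∀ n : ℕ, N ≤ n →
      ∀ (Ω : Type u) (mΩ : MeasurableSpace Ω) (μ : Measure Ω) [IsProbabilityMeasure μ]
        (ℱ : Filtration ℕ mΩ) (x : ℕ → Ω → Fin n → ℕ),
        IsAllocationProcess μ ℱ c cmax x →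
        1 - (n : ℝ)⁻¹ ≤ μ.real {ω | κ * Real.log n ≤ gap (x ⌊C * n * Real.log n⌋₊ ω)} := by
  obtain ⟨α, hα, hrate⟩ := exists_growth_rate hc hcm
  have hα1 : 0 ≤ Real.exp α - 1 := by linarith [Real.add_one_le_exp α]
  -- `C` is so small that `exp (α * h) = n ^ (1 / 8)` for the threshold `h`
  set C := 1 / (8 * (α * (cmax + 1))) with hC
  have hC0 : 0 < C := by positivity
  set K := cmax * Real.exp (α * cmax) + (Real.exp α - 1) * c with hK
  have hK0 : 0 ≤ K := by positivity
  obtain ⟨N, hN⟩ := eventually_growth_le K ((Real.exp α - 1) * c) C hC0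
  refine ⟨C, C, hC0, hC0, N, fun n hn Ω mΩ μ _ ℱ x hx => ?_⟩
  obtain ⟨hn1, hl1, hnL, hm2, hlog2, hKu, hfin⟩ := hN n hn
  have hn1' : (1 : ℝ) ≤ n := by exact_mod_cast hn1
  set l := Real.log n with hl
  set m := ⌊C * n * l⌋₊ with hmdef
  have hmle : (m : ℝ) ≤ C * n * l := Nat.floor_le (by positivity)
  have hmge : C * n * l < m + 1 := Nat.lt_floor_add_one _
  set h := (cmax + 1) * C * l with hh
  have hαh : α * h = l / 8 := by rw [hh, hC]; field_simp
  set U := Real.exp (l / 8) with hU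
  have hU1 : 1 ≤ U := Real.one_le_exp (by positivity)
  have hU8 : U ^ 8 = n := by
    rw [hU, ← Real.exp_nat_mul]
    have : ((8 : ℕ) : ℝ) * (l / 8) = l := by push_cast; ring
    rw [this, hl, Real.exp_log (by linarith)]
  have hU0 : 0 < U := by linarith
  have hB1 : cmax * Real.exp (α * cmax) * Real.exp (α * h) ≤ K * U := by
    rw [hαh]
    exact mul_le_mul_of_nonneg_right (by rw [hK]; linarith [mul_nonneg hα1 hc.le]) hU0.le
  have hB2 : (Real.exp α - 1) * (c / n) * (n * Real.exp (α * h)) ≤ K * U := by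
    rw [hαh]
    have : (Real.exp α - 1) * (c / n) * (n * U) = (Real.exp α - 1) * c * U := by field_simp
    rw [this]
    refine mul_le_mul_of_nonneg_right ?_ hU0.le
    rw [hK]; linarith [show 0 ≤ cmax * Real.exp (α * cmax) by positivity]
  -- the scale `n ^ (-1 / 2)` balances the linear gain `s * n` against the quadratic loss
  set s := (U ^ 4)⁻¹ with hs
  have hsB : s * (K * U) ≤ 1 := by
    rw [hs, inv_mul_le_iff₀ (by positivity), mul_one]
    calc K * U ≤ U * U := mul_le_mul_of_nonneg_right hKu hU0.le
      _ = U ^ 2 := by ring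
      _ ≤ U ^ 4 := pow_le_pow_right₀ hU1 (by norm_num)
  set r := (Real.exp α - 1) * (c / n) with hr
  have hr0 : 0 ≤ r := by positivity
  have hr1 : r ≤ 1 := by
    rw [hr, ← mul_div_assoc]; exact (div_le_one (by linarith)).2 hnL
  have hgrow : 2 * Real.exp (α * h) ≤ (1 + r) ^ m := by
    have hlogr : r / 2 ≤ Real.log (1 + r) := by
      have h1 := Real.one_sub_inv_le_log_of_pos (show 0 < 1 + r by linarith)
      have h2 : r / 2 ≤ 1 - (1 + r)⁻¹ := by
        have : 1 - (1 + r)⁻¹ = r / (1 + r) := by field_simp; ring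
        rw [this]
        exact div_le_div_of_nonneg_left hr0 (by linarith) (by linarith)
      linarith
    have hmhalf : C * n * l / 2 ≤ m := by linarith
    have hexpo : Real.log 2 + α * h ≤ m * Real.log (1 + r) := by
      calc Real.log 2 + α * h ≤ C * l + α * h := by linarith
        _ = C * l * (α * (cmax + 1) + 1) := by rw [hh]; ring
        _ ≤ C * l * ((Real.exp α - 1) * c / 4) :=
            mul_le_mul_of_nonneg_left hrate (by positivity)
        _ = C * n * l / 2 * (r / 2) := by rw [hr]; field_simp; ring
        _ ≤ m * Real.log (1 + r) := mul_le_mul hmhalf hlogr (by positivity) (by positivity)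
    have := Real.exp_le_exp.2 hexpo
    rwa [Real.exp_add, Real.exp_log (by norm_num), Real.exp_nat_mul,
      Real.exp_log (by linarith)] at this
  have hprob := hx.measureReal_forall_lt_le hα.le hc.le (inv_nonneg.2 (by positivity)) hB1 hB2 hsB
    hgrow
  have hbound : Real.exp (m * (s * (K * U)) ^ 2 - s * n / 2) ≤ (n : ℝ)⁻¹ := by
    rw [← Real.exp_log (show (0 : ℝ) < (n : ℝ)⁻¹ by positivity), Real.log_inv]
    refine Real.exp_le_exp.2 ?_
    -- the exponent is at most `C * l * K ^ 2 * U ^ 2 - U ^ 4 / 2`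
    have h1 : s * n = U ^ 4 := by rw [hs, ← hU8]; field_simp
    have h2 : n * (s * (K * U)) ^ 2 = K ^ 2 * U ^ 2 := by rw [hs, ← hU8]; field_simp
    have h3 : m * (s * (K * U)) ^ 2 ≤ C * l * (K ^ 2 * U ^ 2) := by
      rw [← h2]
      calc _ ≤ C * n * l * (s * (K * U)) ^ 2 := mul_le_mul_of_nonneg_right hmle (by positivity)
        _ = _ := by ring
    have h4 : (K ^ 2 * C + 1) * l * U ^ 2 ≤ U ^ 2 / 2 * U ^ 2 :=
      mul_le_mul_of_nonneg_right hfin (by positivity)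
    have h5 : l ≤ l * U ^ 2 := le_mul_of_one_le_right (by linarith) (one_le_pow₀ hU1)
    rw [h1]
    have h6 : (K ^ 2 * C + 1) * l * U ^ 2 = C * l * (K ^ 2 * U ^ 2) + l * U ^ 2 := by ring
    have h7 : U ^ 2 / 2 * U ^ 2 = U ^ 4 / 2 := by ring
    rw [h6, h7] at h4
    linarith only [h3, h4, h5]
  refine one_sub_inv_le_measureReal (G := {ω | ∀ i, (x m ω i : ℝ) < h}) (hx.measurable m
    (MeasurableSet.of_discrete (s := {z : Fin n → ℕ | ∀ i, (z i : ℝ) < h})))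
    (hprob.trans hbound) ?_
  filter_upwards [hx.total_le_mul m] with ω hω hG
  obtain ⟨i, hi⟩ : ∃ i, h ≤ (x m ω i : ℝ) := by
    by_contra! hcon
    exact hG hcon
  have havg : (∑ j, (x m ω j : ℝ)) / n ≤ C * l * cmax := by
    rw [div_le_iff₀ (by linarith)]
    calc _ ≤ m * cmax := hω
      _ ≤ C * n * l * cmax := mul_le_mul_of_nonneg_right hmle hcm.le
      _ = _ := by ring
  have := le_gap_of_le hi havg
  change C * l ≤ gap (x m ω)
  rw [hh] at this
  linarith

/-! ### The three concrete processes -/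

section Allocate

variable {n : ℕ}

lemma le_allocate (x : Fin n → ℕ) (i : Fin n) (k : ℕ) : x ≤ allocate x i k :=
  le_self_add

lemma lt_allocate_self (x : Fin n → ℕ) (i : Fin n) {k : ℕ} (hk : 0 < k) :
    x i < allocate x i k i := by
  simpa [allocate] using hk

lemma sum_allocate (x : Fin n → ℕ) (i : Fin n) (k : ℕ) :
    ∑ j, (allocate x i k j : ℝ) = ∑ j, (x j : ℝ) + k := by
  have h : ∑ j, allocate x i k j = ∑ j, x j + k := by
    simp [allocate, Finset.sum_add_distrib]
  exact_mod_cast h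

lemma gap_sub_inv_le_gap_allocate (x : Fin n → ℕ) (i : Fin n) :
    gap x - (n : ℝ)⁻¹ ≤ gap (allocate x i 1) := by
  have h1 : (⨆ j, (x j : ℝ)) ≤ ⨆ j, (allocate x i 1 j : ℝ) :=
    ciSup_mono (Set.finite_range _).bddAbove fun j => by exact_mod_cast le_allocate x i 1 j
  have h2 : (∑ j, (allocate x i 1 j : ℝ)) / n = (∑ j, (x j : ℝ)) / n + (n : ℝ)⁻¹ := by
    rw [sum_allocate, add_div]; simp
  unfold gap
  linarith

/-- At least `n * δ / 2` bins are heavy, once `n * δ` is at least `2`. -/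
lemma le_card_not_isLight {δ : ℝ} (hδ : δ < 1) (hn : 2 ≤ n * δ) (R : Equiv.Perm (Fin n))
    [DecidablePred (IsLight δ R)] :
    n * δ / 2 ≤ ((Finset.univ.filter fun j => ¬ IsLight δ R j).card : ℝ) := by
  have h1 : (Finset.univ.filter fun k : Fin n => (k : ℕ) < ⌊n * δ⌋₊).card ≤
      (Finset.univ.filter fun j => ¬ IsLight δ R j).card := by
    refine Finset.card_le_card_of_injOn R.symm (fun k hk => ?_) R.symm.injective.injOn
    have hk' : (k : ℕ) + 1 ≤ ⌊n * δ⌋₊ := (Finset.mem_filter.1 hk).2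
    have h2 : ((k : ℕ) : ℝ) + 1 ≤ n * δ := by
      exact_mod_cast (Nat.le_floor_iff (by linarith)).1 hk'
    simpa [IsLight] using h2
  have h3 : ⌊n * δ⌋₊ ≤ n := Nat.floor_le_of_le (by nlinarith [(n.cast_nonneg : (0 : ℝ) ≤ n)])
  rw [Fin.card_filter_val_lt, min_eq_right h3] at h1
  have h4 : (⌊n * δ⌋₊ : ℝ) ≤ (Finset.univ.filter fun j => ¬ IsLight δ R j).card := by
    exact_mod_cast h1
  linarith [Nat.lt_floor_add_one (n * δ)]

end Allocate

section Processes

variable {Ω : Type u} {mΩ : MeasurableSpace Ω} {μ : Measure Ω} {ℱ : Filtration ℕ mΩ} {n : ℕ}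
  {δ : ℝ} {x : ℕ → Ω → Fin n → ℕ}

lemma IsRankingProcess.measurableSet_isLight {R : ℕ → Ω → Equiv.Perm (Fin n)}
    (hR : IsRankingProcess μ ℱ x R) (t : ℕ) (i : Fin n) :
    MeasurableSet[ℱ t] {ω | IsLight δ (R t ω) i} :=
  hR.1 t i (MeasurableSet.of_discrete (s := {k : Fin n | (n : ℝ) * δ < ((k : ℕ) : ℝ) + 1}))

/-- A single further allocation after an even time costs at most `1 / n` of the gap. -/
lemma IsResetMemory.gap_sub_inv_le (hx : IsResetMemory μ ℱ x) (m : ℕ) :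
    ∀ᵐ ω ∂μ, gap (x (2 * (m / 2)) ω) - (n : ℝ)⁻¹ ≤ gap (x m ω) := by
  obtain ⟨-, -, S, -, hstep⟩ := hx
  filter_upwards [hstep (m / 2)] with ω hω
  rcases Nat.mod_two_eq_zero_or_one m with h | h
  · have hm : 2 * (m / 2) = m := by omega
    rw [hm]
    exact sub_le_self _ (by positivity)
  · have hm : 2 * (m / 2) + 1 = m := by omega
    have h1 := hω.1
    rw [hm] at h1
    rw [h1]
    exact gap_sub_inv_le_gap_allocate _ _

variable [IsProbabilityMeasure μ]

/-- If bin `i` gains a ball whenever it is sampled, it gains one with conditional probability at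
least `1 / n`. -/
lemma IsUniformSampling.inv_le_condExp {S : ℕ → Ω → Fin n} (hS : IsUniformSampling μ ℱ S) (t : ℕ)
    (i : Fin n) {A : Set Ω} (hA : MeasurableSet A) (hSA : ∀ᵐ ω ∂μ, S t ω = i → ω ∈ A) :
    ∀ᵐ ω ∂μ, 1 / (n : ℝ) ≤ (μ⟦A | ℱ t⟧) ω := by
  have hn : 0 < n := i.pos
  refine hS.le_condExp t (D := fun _ a => a = i) (fun a => MeasurableSet.const _) hA hSA
    (Filter.Eventually.of_forall fun ω => ?_) (by simpa using hn)
  have hn' : (n : ℝ) ≠ 0 := by positivity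
  have hcard : (Finset.univ.filter fun a => a = i).card = 1 := by simp [Finset.filter_eq']
  rw [hcard, Fintype.card_fin]
  simp [hn']

lemma IsTwinningWithQuantile.isAllocationProcess (hx : IsTwinningWithQuantile μ ℱ δ x) :
    IsAllocationProcess μ ℱ 1 2 x := by
  obtain ⟨had, h0, S, R, hS, hR, hstep⟩ := hx
  refine ⟨had, h0, fun t => ?_, fun t => ?_, fun t i => ?_⟩
  · filter_upwards [hstep t] with ω hω
    rw [hω]
    exact le_allocate _ _ _
  · filter_upwards [hstep t] with ω hω
    rw [hω, sum_allocate]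
    split_ifs <;> norm_num
  · refine hS.inv_le_condExp t i (measurableSet_lt ((had t).mono (ℱ.le t) le_rfl)
      ((had (t + 1)).mono (ℱ.le (t + 1)) le_rfl) i) ?_
    filter_upwards [hstep t] with ω hω hSi
    rw [hω, hSi]
    exact lt_allocate_self _ _ (by split_ifs <;> norm_num)

/-- A light bin receives a ball when it is the first sample; a heavy bin receives balls when it
is the second sample and the first one is any of the at least `n * δ / 2` heavy bins. -/
lemma IsQuantileWithPenalty.isAllocationProcess (hδ0 : 0 < δ) (hδ : δ < 1) (hn : 2 ≤ n * δ)
    (hx : IsQuantileWithPenalty μ ℱ δ x) : IsAllocationProcess μ ℱ (δ / 2) 2 x := by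
  classical
  obtain ⟨had, h0, S, R, hS, hR, hstep⟩ := hx
  have hn0 : (0 : ℝ) < n := pos_of_mul_pos_left (by linarith) hδ0.le
  refine ⟨had, h0, fun t => ?_, fun t => ?_, fun t i => ?_⟩
  · filter_upwards [hstep t] with ω hω
    rw [hω]
    split_ifs <;> exact le_allocate _ _ _
  · filter_upwards [hstep t] with ω hω
    rw [hω]
    split_ifs <;> rw [sum_allocate] <;> norm_num
  · refine hS.le_condExp t (D := fun ω a => (IsLight δ (R t ω) a.1 ∧ a.1 = i) ∨
      (¬ IsLight δ (R t ω) a.1 ∧ a.2 = i)) (fun a => ?_)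
      (measurableSet_lt ((had t).mono (ℱ.le t) le_rfl)
        ((had (t + 1)).mono (ℱ.le (t + 1)) le_rfl) i) ?_
      (Filter.Eventually.of_forall fun ω => ?_) ?_
    · have hL := hR.measurableSet_isLight (δ := δ) t a.1
      exact (hL.inter (MeasurableSet.const _)).union (hL.compl.inter (MeasurableSet.const _))
    · filter_upwards [hstep t] with ω hω hD
      rw [hω]
      rcases hD with ⟨h1, h2⟩ | ⟨h1, h2⟩
      · rw [if_pos h1, h2]
        exact lt_allocate_self _ _ one_pos
      · rw [if_neg h1, h2]
        exact lt_allocate_self _ _ two_pos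
    · rw [Fintype.card_prod, Fintype.card_fin]
      push_cast
      have hval : δ / 2 / n * (n * n) = n * δ / 2 := by field_simp
      rw [hval]
      by_cases hi : IsLight δ (R t ω) i
      · have h1 : (Finset.univ : Finset (Fin n)).card ≤ (Finset.univ.filter fun a : Fin n × Fin n =>
            (IsLight δ (R t ω) a.1 ∧ a.1 = i) ∨ (¬ IsLight δ (R t ω) a.1 ∧ a.2 = i)).card :=
          Finset.card_le_card_of_injOn (fun j => (i, j)) (fun j _ => by simp [hi])
            fun j _ k _ h => (Prod.ext_iff.1 h).2
        rw [Finset.card_univ, Fintype.card_fin] at h1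
        refine le_trans ?_ (Nat.cast_le.2 h1)
        nlinarith
      · have h1 : (Finset.univ.filter fun j => ¬ IsLight δ (R t ω) j).card ≤
            (Finset.univ.filter fun a : Fin n × Fin n =>
            (IsLight δ (R t ω) a.1 ∧ a.1 = i) ∨ (¬ IsLight δ (R t ω) a.1 ∧ a.2 = i)).card :=
          Finset.card_le_card_of_injOn (fun j => (j, i))
            (fun j hj => by simpa using Or.inr (Finset.mem_filter.1 hj).2)
            fun j _ k _ h => (Prod.ext_iff.1 h).1
        exact (le_card_not_isLight hδ hn (R t ω)).trans (Nat.cast_le.2 h1)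
    · have : 0 < n := by exact_mod_cast hn0
      rw [Fintype.card_prod, Fintype.card_fin]
      positivity

/-- The history at even times. -/
def evenFiltration (ℱ : Filtration ℕ mΩ) : Filtration ℕ mΩ where
  seq t := ℱ (2 * t)
  mono' _ _ h := ℱ.mono (Nat.mul_le_mul_left 2 h)
  le' t := ℱ.le (2 * t)

/-- An even step and the odd step after it form one round of an allocation process. -/
lemma IsResetMemory.isAllocationProcess (hx : IsResetMemory μ ℱ x) :
    IsAllocationProcess μ (evenFiltration ℱ) 1 2 (fun t => x (2 * t)) := by
  obtain ⟨had, h0, S, hS, hstep⟩ := hx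
  refine ⟨fun t => had (2 * t), h0, fun t => ?_, fun t => ?_, fun t i => ?_⟩
  · filter_upwards [hstep t] with ω hω
    change x (2 * t) ω ≤ x (2 * t + 2) ω
    rw [hω.2, hω.1]
    exact (le_allocate _ _ _).trans (le_allocate _ _ _)
  · filter_upwards [hstep t] with ω hω
    change (∑ i, (x (2 * t + 2) ω i : ℝ)) - (∑ i, (x (2 * t) ω i : ℝ)) ≤ 2
    rw [hω.2, sum_allocate, hω.1, sum_allocate]
    norm_num
    linarith
  · refine hS.inv_le_condExp (2 * t) i (measurableSet_lt ((had (2 * t)).mono (ℱ.le _) le_rfl)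
      ((had (2 * (t + 1))).mono (ℱ.le _) le_rfl) i) ?_
    filter_upwards [hstep t] with ω hω hSi
    change x (2 * t) ω i < x (2 * t + 2) ω i
    rw [hω.2]
    refine lt_of_lt_of_le ?_ (le_allocate _ _ _ i)
    rw [hω.1, hSi]
    exact lt_allocate_self _ _ one_pos

end Processes

theorem IsResetMemory.exists_gap_ge :
    ∃ C κ : ℝ, 0 < C ∧ 0 < κ ∧ ∃ N : ℕ, ∀ n : ℕ, N ≤ n →
      ∀ (Ω : Type u) (mΩ : MeasurableSpace Ω) (μ : Measure Ω) [IsProbabilityMeasure μ]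
        (ℱ : Filtration ℕ mΩ) (x : ℕ → Ω → Fin n → ℕ),
        IsResetMemory μ ℱ x →
        1 - (n : ℝ)⁻¹ ≤ μ.real {ω | κ * Real.log n ≤ gap (x ⌊C * n * Real.log n⌋₊ ω)} := by
  obtain ⟨C, κ, hC, hκ, N, hN⟩ := IsAllocationProcess.exists_gap_ge.{u} 1 2 one_pos two_pos
  have hlog : Filter.Tendsto (fun n : ℕ => κ / 2 * Real.log n) Filter.atTop Filter.atTop :=
    (Real.tendsto_log_atTop.comp tendsto_natCast_atTop_atTop).const_mul_atTop (by positivity)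
  obtain ⟨N', hN'⟩ := Filter.eventually_atTop.1 (hlog.eventually_ge_atTop 1)
  refine ⟨2 * C, κ / 2, by positivity, by positivity, max 1 (max N N'),
    fun n hn Ω mΩ μ _ ℱ x hx => ?_⟩
  have hn1 : (1 : ℝ) ≤ n := by exact_mod_cast (le_max_left _ _).trans hn
  have hinv : (n : ℝ)⁻¹ ≤ 1 := inv_le_one_of_one_le₀ hn1
  have hl := hN' n ((le_max_right _ _).trans ((le_max_right _ _).trans hn))
  refine (hN n ((le_max_left _ _).trans ((le_max_right _ _).trans hn)) Ω mΩ μ (evenFiltration ℱ) _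
    hx.isAllocationProcess).trans (ENNReal.toReal_mono (measure_ne_top μ _) (measure_mono_ae ?_))
  -- after `⌊2 * C * n * log n⌋` single steps exactly `⌊C * n * log n⌋` rounds are complete
  have hfloor : ⌊C * n * Real.log n⌋₊ = ⌊2 * C * n * Real.log n⌋₊ / 2 := by
    rw [← Nat.floor_div_ofNat]
    congr 1
    change _ = 2 * C * n * Real.log n / 2
    ring
  filter_upwards [hx.gap_sub_inv_le ⌊2 * C * n * Real.log n⌋₊] with ω hω hgap
  change κ / 2 * Real.log n ≤ gap (x ⌊2 * C * n * Real.log n⌋₊ ω)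
  have hgap' : κ * Real.log n ≤ gap (x (2 * ⌊C * n * Real.log n⌋₊) ω) := hgap
  rw [hfloor] at hgap'
  linarith

end BallsBins

theorem mainTheorem10 :
    (∀ c cmax : ℝ, 0 < c → 0 < cmax →
      ∃ C κ : ℝ, 0 < C ∧ 0 < κ ∧ ∃ N : ℕ, ∀ n : ℕ, N ≤ n →
        ∀ (Ω : Type u) (mΩ : MeasurableSpace Ω) (μ : Measure Ω) [IsProbabilityMeasure μ]
          (ℱ : Filtration ℕ mΩ) (x : ℕ → Ω → Fin n → ℕ),
          BallsBins.IsAllocationProcess μ ℱ c cmax x →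
          1 - (n : ℝ)⁻¹ ≤
            μ.real {ω | κ * Real.log n ≤ BallsBins.gap (x ⌊C * n * Real.log n⌋₊ ω)}) ∧
    (∀ δ : ℝ, 0 < δ → δ < 1 →
      ∃ C κ : ℝ, 0 < C ∧ 0 < κ ∧ ∃ N : ℕ, ∀ n : ℕ, N ≤ n →
        ∀ (Ω : Type u) (mΩ : MeasurableSpace Ω) (μ : Measure Ω) [IsProbabilityMeasure μ]
          (ℱ : Filtration ℕ mΩ) (x : ℕ → Ω → Fin n → ℕ),
          BallsBins.IsTwinningWithQuantile μ ℱ δ x →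
          1 - (n : ℝ)⁻¹ ≤
            μ.real {ω | κ * Real.log n ≤ BallsBins.gap (x ⌊C * n * Real.log n⌋₊ ω)}) ∧
    (∀ δ : ℝ, 0 < δ → δ < 1 →
      ∃ C κ : ℝ, 0 < C ∧ 0 < κ ∧ ∃ N : ℕ, ∀ n : ℕ, N ≤ n →
        ∀ (Ω : Type u) (mΩ : MeasurableSpace Ω) (μ : Measure Ω) [IsProbabilityMeasure μ]
          (ℱ : Filtration ℕ mΩ) (x : ℕ → Ω → Fin n → ℕ),
          BallsBins.IsQuantileWithPenalty μ ℱ δ x →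
          1 - (n : ℝ)⁻¹ ≤
            μ.real {ω | κ * Real.log n ≤ BallsBins.gap (x ⌊C * n * Real.log n⌋₊ ω)}) ∧
    (∃ C κ : ℝ, 0 < C ∧ 0 < κ ∧ ∃ N : ℕ, ∀ n : ℕ, N ≤ n →
        ∀ (Ω : Type u) (mΩ : MeasurableSpace Ω) (μ : Measure Ω) [IsProbabilityMeasure μ]
          (ℱ : Filtration ℕ mΩ) (x : ℕ → Ω → Fin n → ℕ),
          BallsBins.IsResetMemory μ ℱ x →
          1 - (n : ℝ)⁻¹ ≤
            μ.real {ω | κ * Real.log n ≤ BallsBins.gap (x ⌊C * n * Real.log n⌋₊ ω)}) := by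
  refine ⟨BallsBins.IsAllocationProcess.exists_gap_ge, fun δ _ _ => ?_, fun δ hδ0 hδ => ?_,
    BallsBins.IsResetMemory.exists_gap_ge⟩
  · obtain ⟨C, κ, hC, hκ, N, hN⟩ :=
      BallsBins.IsAllocationProcess.exists_gap_ge.{u} 1 2 one_pos two_pos
    exact ⟨C, κ, hC, hκ, N, fun n hn Ω mΩ μ _ ℱ x hx =>
      hN n hn Ω mΩ μ ℱ x hx.isAllocationProcess⟩
  · obtain ⟨C, κ, hC, hκ, N, hN⟩ :=
      BallsBins.IsAllocationProcess.exists_gap_ge.{u} (δ / 2) 2 (by positivity) two_pos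
    refine ⟨C, κ, hC, hκ, max N ⌈2 / δ⌉₊, fun n hn Ω mΩ μ _ ℱ x hx =>
      hN n ((le_max_left _ _).trans hn) Ω mΩ μ ℱ x (hx.isAllocationProcess hδ0 hδ ?_)⟩
    exact (div_le_iff₀ hδ0).1 (Nat.ceil_le.1 ((le_max_right _ _).trans hn))
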